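/- Let $\mathcal X$ be a real Hilbert space, let $A,B:\mathcal X\to 2^{\mathcal X}$ be maximal monotone operators, and let $C:\mathcal X\to\mathcal X$ be $\beta$-cocoercive with $\beta>0$, i.e. $\langle x-y,Cx-Cy\rangle\ge\beta\|Cx-Cy\|^2$ for all $x,y$. Let $\mathrm{zer}(A+B+C)=\{x: 0\in Ax+Bx+Cx\}$ and let $J_M=(I+M)^{-1}$ denote the resolvent of a maximal monotone operator $M$. For $\gamma\in(0,2\beta]$ and $z\in\mathcal X$ put $$x_B(z)=J_{\gamma B}(z),\qquad x_A(z)=J_{\gamma A}\bigl(2x_B(z)-z-\gamma Cx_B(z)\bigr),\qquad x_C(z)=J_{\gamma C}\bigl(x_A(z)+\gamma Cx_B(z)\bigr),$$ and $Tz=x_C(z)+z-x_B(z)$. Assume that $T$ is $a$-averaged with $a=\frac{2\beta}{4\beta-\gamma}<1$, i.e. $T=(1-a)I+aN$ for some nonexpansive map $N:\mathcal X\to\mathcal X$. Let $(\lambda_j)_{j\ge0}\subseteq(0,\frac1a)=\bigl(0,\frac{4\beta-\gamma}{2\beta}\bigr)$ satisfy $\sum_{j=0}^\infty a\lambda_j(1-a\lambda_j)=\infty$,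 let $z^0\in\mathcal X$, and let $z^{j+1}=z^j+\lambda_j\bigl(x_C(z^j)-x_B(z^j)\bigr)$ for $j\ge0$. If $\mathrm{zer}(A+B+C)\neq\emptyset$, then $(z^j)$ converges weakly to a fixed point of $T$. Moreover: 1. Suppose that $\inf_{j\ge0}\lambda_j>0$ and that $z^*$ is the weak limit of $(z^j)$. Then (a) $Cx_B(z^j)\to Cx^*$ strongly for every $x^*\in\mathrm{zer}(A+B+C)$; (b) $x_B(z^j)\rightharpoonup J_{\gamma B}(z^*)$ weakly, and $J_{\gamma B}(z^*)\in\mathrm{zer}(A+B+C)$; (c) $x_A(z^j)\rightharpoonup J_{\gamma B}(z^*)$ weakly; (d) $x_C(z^j)\rightharpoonup J_{\gamma B}(z^*)$ weakly. 2. Suppose that $\mathrm{zer}(A+B+C)\ne\emptyset$. Then the sequences $(x_B(z^j))$ and $(x_C(z^j))$ converge strongly to a common point of $\mathrm{zer}(A+B+C)$ if any one of the following holds: (a) $A$ is uniformly monotone on every nonempty bounded subset of $\mathrm{dom}(A)$; (b) $B$ is uniformly monotone on every nonempty bounded subset of $\mathrm{dom}(B)$; (c) $C$ is demiregular at every point of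 $\mathrm{zer}(A+B+C)$. Here $M$ is uniformly monotone on $S$ if there is a nondecreasing $\phi:[0,\infty)\to[0,\infty]$ vanishing only at $0$ such that $\langle x-y,u-v\rangle\ge\phi(\|x-y\|)$ for all $x,y\in S$, $u\in Mx$, $v\in My$; and $C$ is demiregular at $x$ if $x_n\rightharpoonup x$ and $Cx_n\to Cx$ imply $x_n\to x$. -/

import Mathlib

open Filter Topology Set
open scoped Pointwise NNReal ENNReal

namespace ThreeOp

section Operators

variable {X : Type*} [NormedAddCommGroup X] [InnerProductSpace ℝ X]

/-- The graph of a set-valued operator. -/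
def graph (A : X → Set X) : Set (X × X) := {p | p.2 ∈ A p.1}

/-- The domain of a set-valued operator. -/
def dom (A : X → Set X) : Set X := {x | (A x).Nonempty}

/-- The set of zeros of a set-valued operator. -/
def zer (A : X → Set X) : Set X := {x | (0 : X) ∈ A x}

/-- The inverse of a set-valued operator: its graph is the transposed graph. -/
def inverse (A : X → Set X) : X → Set X := fun y => {x | y ∈ A x}

/-- A single-valued map, seen as a set-valued operator. -/
def ofMap (C : X → X) : X → Set X := fun x => {C x}

/-- Monotone set-valued operators. -/
def MonotoneOp (A : X → Set X) : Prop :=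
  ∀ ⦃x y u v : X⦄, u ∈ A x → v ∈ A y → 0 ≤ inner ℝ (x - y) (u - v)

/-- Maximal monotone operators: the graph is not properly contained in the graph of another
monotone operator. -/
def MaximalMonotoneOp (A : X → Set X) : Prop :=
  MonotoneOp A ∧ ∀ A' : X → Set X, MonotoneOp A' → graph A ⊆ graph A' → graph A' = graph A

/-- A map `C : X → X` is `β`-cocoercive. -/
def Cocoercive (β : ℝ) (C : X → X) : Prop :=
  ∀ x y : X, β * ‖C x - C y‖ ^ 2 ≤ inner ℝ (x - y) (C x - C y)

/-- `A` is uniformly monotone on `S`: there is a nondecreasing modulus `φ : [0,∞) → [0,∞]` that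
vanishes only at `0`, with `⟪x - y, u - v⟫ ≥ φ ‖x - y‖` for `x, y ∈ S`, `u ∈ A x`, `v ∈ A y`. -/
def UniformlyMonotoneOn (A : X → Set X) (S : Set X) : Prop :=
  ∃ φ : ℝ≥0 → ℝ≥0∞, Monotone φ ∧ (∀ t, φ t = 0 ↔ t = 0) ∧
    ∀ x ∈ S, ∀ y ∈ S, ∀ u ∈ A x, ∀ v ∈ A y,
      ((φ ‖x - y‖₊ : ℝ≥0∞) : EReal) ≤ ((inner ℝ (x - y) (u - v) : ℝ) : EReal)

/-- `A` is uniformly monotone on every nonempty bounded subset of its domain. -/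
def UniformlyMonotoneOnBounded (A : X → Set X) : Prop :=
  ∀ S : Set X, S.Nonempty → Bornology.IsBounded S → S ⊆ dom A → UniformlyMonotoneOn A S

/-- Weak convergence of a sequence. -/
def WeakTendsto (x : ℕ → X) (l : X) : Prop :=
  Tendsto (fun n => toWeakSpace ℝ X (x n)) atTop (𝓝 (toWeakSpace ℝ X l))

/-- `A` is demiregular at `x`: if `(x n, u n)` lies in the graph of `A`, `x n ⇀ x` weakly and
`u n → u` strongly for some `u ∈ A x`, then `x n → x` strongly. -/
def DemiregularAt (A : X → Set X) (x : X) : Prop :=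
  ∀ u ∈ A x, ∀ (xs us : ℕ → X), (∀ n, us n ∈ A (xs n)) →
    WeakTendsto xs x → Tendsto us atTop (𝓝 u) → Tendsto xs atTop (𝓝 x)

/-- `F` is `a`-averaged: `F = (1 - a) I + a N` for some nonexpansive map `N`. -/
def Averaged (a : ℝ) (F : X → X) : Prop :=
  ∃ N : X → X, LipschitzWith 1 N ∧ ∀ x, F x = (1 - a) • x + a • N x

/-- The resolvent `(I + A)⁻¹`, as a set-valued operator. -/
def resolventOp (A : X → Set X) : X → Set X := inverse (ofMap id + A)

/-- The resolvent `(I + A)⁻¹` as a map: the element of `resolventOp A y`. For maximal monotone `A`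
this set has exactly one element (Minty); if the set is empty the value is unspecified. -/
noncomputable def J (A : X → Set X) (y : X) : X :=
  Classical.epsilon (fun x => x ∈ resolventOp A y)

/-- `x_B = J_{γB} z`. -/
noncomputable def stepB (γ : ℝ) (B : X → Set X) (z : X) : X := J (γ • B) z

/-- `x_A = J_{γA} (2 x_B - z - γ C x_B)`. -/
noncomputable def stepA (γ : ℝ) (A B : X → Set X) (C : X → X) (z : X) : X :=
  J (γ • A) ((2 : ℝ) • stepB γ B z - z - γ • C (stepB γ B z))

/-- `x_C = J_{γC} (x_A + γ C x_B)`. -/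
noncomputable def stepC (γ : ℝ) (A B : X → Set X) (C : X → X) (z : X) : X :=
  J (γ • ofMap C) (stepA γ A B C z + γ • C (stepB γ B z))

/-- The splitting operator
`T = J_{γC} ∘ (J_{γA} ∘ (2 J_{γB} - I - γ C J_{γB}) + γ C J_{γB}) + (I - J_{γB})`. -/
noncomputable def splitT (γ : ℝ) (A B : X → Set X) (C : X → X) (z : X) : X :=
  stepC γ A B C z + (z - stepB γ B z)

end Operators

end ThreeOp

/-! Since `T z - z = x_C - x_B`, writing `T = (1 - a) I + a N` turns the scheme into the
Krasnoselskii–Mann iteration of the nonexpansive map `N` with steps `a * lam j` in `(0, 1)`. The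
fixed points of `N` are those of `T`, and `J_{γB}` maps them onto the zeros of `A + B + C`. Fejér
monotonicity, vanishing residuals and demiclosedness of `N - I` then give a weak limit
(`exists_weaklyConverges_fixed`).

For the shadow sequences, the vanishing residual also gives `x_A - x_B → 0`. The monotonicity gaps
of `A`, `B` and `C` with respect to a solution are nonnegative, and their sum tends to zero
(`exists_gap_bound`), so each gap does. The gap of `C` yields `C x_B → C x`; under uniform
monotonicity, the gap of `A` or `B` yields strong convergence. Weak limits of `x_B` are identified
through the sum of the `A` and `B` gaps, in which the products of two merely weakly convergent
sequences cancel (`mem_of_weaklyConverges_stepB`).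

Part 1 does not assume a zero. A weakly convergent orbit is bounded, and a bounded orbit forces `N`
to have a fixed point (`exists_fixed_of_bounded_orbit`). Resolvents are everywhere defined by
Minty's theorem, proved here with the Fitzpatrick function. -/

namespace ThreeOp

/-! ### Minimising a convex function plus half the squared norm -/

section Minimization

variable {H : Type*} [NormedAddCommGroup H] [InnerProductSpace ℝ H]

/-- On a closed convex epigraph-like set, `t + ‖p‖² / 2` attains its infimum. -/
theorem exists_minimizer_add_sq [CompleteSpace H] {E : Set (H × ℝ)} (hcl : IsClosed E)
    (hcv : Convex ℝ E) (hne : E.Nonempty) {m : ℝ} (hm : ∀ q ∈ E, m ≤ q.2 + ‖q.1‖ ^ 2 / 2) :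
    ∃ p ∈ E, ∀ q ∈ E, p.2 + ‖p.1‖ ^ 2 / 2 ≤ q.2 + ‖q.1‖ ^ 2 / 2 := by
  set g : H × ℝ → ℝ := fun q => q.2 + ‖q.1‖ ^ 2 / 2 with hg
  have hbdd : BddBelow (g '' E) := ⟨m, by rintro _ ⟨q, hq, rfl⟩; exact hm q hq⟩
  obtain ⟨u, -, hu, huE⟩ := exists_seq_tendsto_sInf (hne.image g) hbdd
  choose q hqE hqu using huE
  set I := sInf (g '' E) with hI
  have hI_le : ∀ p ∈ E, I ≤ g p := fun p hp => csInf_le hbdd ⟨p, hp, rfl⟩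
  -- Parallelogram law: the midpoint of two near-minimisers lies in `E`, and strong convexity of the
  -- square bounds their distance.
  have hpar : ∀ k l, ‖(q k).1 - (q l).1‖ ^ 2 ≤ 4 * (u k - I) + 4 * (u l - I) := by
    intro k l
    have hmid := hI_le _ (hcv (hqE k) (hqE l) (by norm_num : (0 : ℝ) ≤ 1 / 2)
      (by norm_num : (0 : ℝ) ≤ 1 / 2) (by norm_num))
    have hk := hqu k
    have hl := hqu l
    have e1 := norm_sub_sq_real (q k).1 (q l).1
    have e2 := norm_add_sq_real (q k).1 (q l).1
    have e3 : ‖(1 / 2 : ℝ) • (q k).1 + (1 / 2 : ℝ) • (q l).1‖ ^ 2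
        = ‖(q k).1 + (q l).1‖ ^ 2 / 4 := by
      rw [← smul_add, norm_smul, mul_pow]; norm_num; ring
    simp only [hg, Prod.fst_add, Prod.snd_add, Prod.smul_fst, Prod.smul_snd, smul_eq_mul] at hmid hk hl
    rw [e3] at hmid
    linarith
  have hcau : CauchySeq fun k => (q k).1 := by
    rw [Metric.cauchySeq_iff]
    intro ε hε
    have hev : ∀ᶠ k in atTop, u k < I + ε ^ 2 / 8 :=
      hu.eventually_lt_const (by have := sq_pos_of_pos hε; linarith)
    obtain ⟨n, hn⟩ := eventually_atTop.1 hev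
    refine ⟨n, fun k hk l hl => ?_⟩
    rw [dist_eq_norm]
    refine lt_of_pow_lt_pow_left₀ 2 hε.le ?_
    have := hpar k l
    have := hn k hk
    have := hn l hl
    linarith
  obtain ⟨p, hp⟩ := cauchySeq_tendsto_of_complete hcau
  have ht : Tendsto (fun k => (q k).2) atTop (𝓝 (I - ‖p‖ ^ 2 / 2)) := by
    have h := hu.sub ((hp.norm.pow 2).div_const 2)
    refine h.congr fun k => ?_
    rw [← hqu k]; simp [hg]
  refine ⟨(p, I - ‖p‖ ^ 2 / 2), hcl.mem_of_tendsto (hp.prodMk_nhds ht)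
    (Eventually.of_forall hqE), fun r hr => ?_⟩
  have := hI_le r hr
  simp only [hg] at this
  simpa using this

/-- A supremum of affine functions `p ↦ ⟪p, c i⟫ - s i`, finite at some point, has a point `p₀`
at which `-p₀` is a subgradient. -/
theorem exists_subgradient_neg_self [CompleteSpace H] {ι : Type*} [Nonempty ι] (c : ι → H)
    (s : ι → ℝ) {p₁ : H} {t₁ : ℝ} (h₁ : ∀ i, inner ℝ p₁ (c i) - s i ≤ t₁) :
    ∃ (p₀ : H) (t₀ : ℝ), (∀ i, inner ℝ p₀ (c i) - s i ≤ t₀) ∧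
      ∀ (p : H) (t : ℝ), (∀ i, inner ℝ p (c i) - s i ≤ t) → t₀ - inner ℝ (p - p₀) p₀ ≤ t := by
  set E : Set (H × ℝ) := {q | ∀ i, inner ℝ q.1 (c i) - s i ≤ q.2} with hE
  have hcl : IsClosed E := by
    have : E = ⋂ i, {q : H × ℝ | inner ℝ q.1 (c i) - s i ≤ q.2} := by ext q; simp [hE]
    rw [this]
    exact isClosed_iInter fun i => isClosed_le (by fun_prop) (by fun_prop)
  have hcv : Convex ℝ E := by
    intro x hx y hy a b ha hb hab i
    have h1 := mul_le_mul_of_nonneg_left (hx i) ha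
    have h2 := mul_le_mul_of_nonneg_left (hy i) hb
    simp only [Prod.fst_add, Prod.snd_add, Prod.smul_fst, Prod.smul_snd, smul_eq_mul,
      inner_add_left, real_inner_smul_left]
    have : s i = a * s i + b * s i := by rw [← add_mul, hab, one_mul]
    linarith
  obtain ⟨i₀⟩ := ‹Nonempty ι›
  have hm : ∀ q ∈ E, -s i₀ - ‖c i₀‖ ^ 2 / 2 ≤ q.2 + ‖q.1‖ ^ 2 / 2 := by
    intro q hq
    have h1 := hq i₀
    have h2 := norm_add_sq_real q.1 (c i₀)
    have h3 := sq_nonneg ‖q.1 + c i₀‖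
    linarith
  obtain ⟨⟨p₀, t₀⟩, hp, hmin⟩ := exists_minimizer_add_sq hcl hcv ⟨(p₁, t₁), h₁⟩ hm
  refine ⟨p₀, t₀, hp, fun p t hpt => ?_⟩
  -- Minimality is compared along the segment towards `(p, t)`, divided by `θ`; letting `θ → 0`
  -- removes the quadratic term.
  have key : ∀ θ : ℝ, 0 < θ → θ ≤ 1 →
      0 ≤ (t - t₀) + inner ℝ (p - p₀) p₀ + θ * (‖p - p₀‖ ^ 2 / 2) := by
    intro θ h0 h1
    have hmem : (p₀, t₀) + θ • ((p, t) - (p₀, t₀)) ∈ E :=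
      hcv.add_smul_sub_mem hp (show (p, t) ∈ E from hpt) ⟨h0.le, h1⟩
    have h := hmin _ hmem
    have e := norm_add_sq_real p₀ (θ • (p - p₀))
    rw [norm_smul, mul_pow, real_inner_smul_right, real_inner_comm, Real.norm_eq_abs,
      sq_abs] at e
    simp only [Prod.fst_add, Prod.snd_add, Prod.smul_fst, Prod.smul_snd, smul_eq_mul,
      Prod.fst_sub, Prod.snd_sub, e] at h
    refine nonneg_of_mul_nonneg_right (a := θ) ?_ h0
    linarith
  have hlim : Tendsto (fun θ : ℝ => (t - t₀) + inner ℝ (p - p₀) p₀ + θ * (‖p - p₀‖ ^ 2 / 2))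
      (𝓝[>] 0) (𝓝 ((t - t₀) + inner ℝ (p - p₀) p₀ + 0 * (‖p - p₀‖ ^ 2 / 2))) :=
    (Continuous.tendsto (by fun_prop) 0).mono_left nhdsWithin_le_nhds
  have h0 := ge_of_tendsto hlim (by
    filter_upwards [Ioc_mem_nhdsGT (zero_lt_one (α := ℝ))] with θ hθ using key θ hθ.1 hθ.2)
  linarith

end Minimization

/-! ### Maximal monotonicity, Minty's theorem and resolvents -/

section Resolvent

theorem mem_resolventOp {X : Type*} [NormedAddCommGroup X] {A : X → Set X} {x y : X} : x ∈ resolventOp A y ↔ y - x ∈ A x := by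
  simp only [resolventOp, inverse, ofMap, mem_ofPred_eq, Pi.add_apply, id, Set.mem_add]
  constructor
  · rintro ⟨_, rfl, v, hv, rfl⟩
    simpa using hv
  · intro h
    exact ⟨x, rfl, _, h, by simp⟩

variable {X : Type*} [NormedAddCommGroup X] [InnerProductSpace ℝ X] {A : X → Set X} {C : X → X}

/-- An operator is maximal monotone if and only if its graph consists of exactly those pairs that
are monotonically related to it. -/
theorem maximalMonotoneOp_iff : MaximalMonotoneOp A ↔ MonotoneOp A ∧
    ∀ x u, (∀ y, ∀ v ∈ A y, 0 ≤ inner ℝ (x - y) (u - v)) → u ∈ A x := by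
  constructor
  · rintro ⟨hmon, hmax⟩
    refine ⟨hmon, fun x u h => ?_⟩
    have hmon' : MonotoneOp fun y => {v | v ∈ A y ∨ (y = x ∧ v = u)} := by
      rintro y y' v v' (hv | ⟨rfl, rfl⟩) (hv' | ⟨rfl, rfl⟩)
      · exact hmon hv hv'
      · rw [← neg_sub, ← neg_sub v', inner_neg_neg]; exact h _ _ hv
      · exact h _ _ hv'
      · simp
    have := hmax _ hmon' fun p hp => Or.inl hp
    have hmem : (x, u) ∈ graph fun y => {v | v ∈ A y ∨ (y = x ∧ v = u)} := Or.inr ⟨rfl, rfl⟩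
    rwa [this] at hmem
  · rintro ⟨hmon, h⟩
    refine ⟨hmon, fun A' hA' hsub => hsub.antisymm' ?_⟩
    rintro ⟨x, u⟩ hxu
    exact h x u fun y v hv => hA' hxu (hsub (show (y, v) ∈ graph A from hv))

theorem MaximalMonotoneOp.smul (hA : MaximalMonotoneOp A) {γ : ℝ} (hγ : 0 < γ) :
    MaximalMonotoneOp (γ • A) := by
  rw [maximalMonotoneOp_iff] at hA ⊢
  refine ⟨?_, fun x u h => ?_⟩
  · rintro x y _ _ ⟨u, hu, rfl⟩ ⟨v, hv, rfl⟩
    simp only [← smul_sub, real_inner_smul_right]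
    exact mul_nonneg hγ.le (hA.1 hu hv)
  · refine ⟨γ⁻¹ • u, hA.2 _ _ fun y v hv => ?_, smul_inv_smul₀ hγ.ne' u⟩
    have h1 := h y (γ • v) (smul_mem_smul_set hv)
    have e : γ⁻¹ • u - v = γ⁻¹ • (u - γ • v) := by rw [smul_sub, inv_smul_smul₀ hγ.ne']
    rw [e, real_inner_smul_right]
    exact mul_nonneg (inv_nonneg.2 hγ.le) h1

theorem MaximalMonotoneOp.translate (hA : MaximalMonotoneOp A) (w : X) :
    MaximalMonotoneOp fun x => {u | u + w ∈ A x} := by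
  rw [maximalMonotoneOp_iff] at hA ⊢
  refine ⟨fun x y u v hu hv => ?_, fun x u h => hA.2 _ _ fun y v hv => ?_⟩
  · simpa using hA.1 hu hv
  · have := h y (v - w) (by simpa using hv)
    rwa [sub_sub_eq_add_sub] at this

/-- The key case of Minty's theorem, by minimising the Fitzpatrick function plus half of the
squared norm. -/
theorem MaximalMonotoneOp.exists_neg_mem [CompleteSpace X] (hA : MaximalMonotoneOp A) :
    ∃ x, -x ∈ A x := by
  have hmax := (maximalMonotoneOp_iff.1 hA).2
  have hmon := hA.1
  have hne : Nonempty (graph A) := by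
    by_contra hcon
    rw [not_nonempty_iff] at hcon
    have h0 := hmax 0 0 fun y v hv => (hcon.false ⟨(y, v), hv⟩).elim
    exact hcon.false ⟨(0, 0), h0⟩
  -- The coordinates are swapped so that the supremum of `⟪·, c p⟫ - s p` is the Fitzpatrick
  -- function of `A`; `hgraph` bounds it on the graph by the duality pairing.
  let c : graph A → WithLp 2 (X × X) := fun p => WithLp.toLp 2 (p.1.2, p.1.1)
  let s : graph A → ℝ := fun p => inner ℝ p.1.1 p.1.2
  have hgraph : ∀ x u, u ∈ A x → ∀ p : graph A,
      inner ℝ (WithLp.toLp 2 (x, u)) (c p) - s p ≤ inner ℝ x u := by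
    rintro x u hu ⟨⟨y, v⟩, hv⟩
    have h := hmon hu hv
    simp only [inner_sub_left, inner_sub_right] at h
    simp only [c, s, WithLp.prod_inner_apply]
    rw [real_inner_comm u y] at h
    linarith
  obtain ⟨⟨⟨x₁, u₁⟩, hx₁⟩⟩ := id hne
  obtain ⟨p₀, t₀, hp₀, hsub⟩ := exists_subgradient_neg_self (t₁ := inner ℝ x₁ u₁) c s (hgraph x₁ u₁ hx₁)
  obtain ⟨x₀, u₀, rfl⟩ : ∃ x₀ u₀, p₀ = WithLp.toLp 2 (x₀, u₀) := ⟨p₀.fst, p₀.snd, rfl⟩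
  -- The Fitzpatrick function dominates the pairing: otherwise `(x₀, u₀)` is strictly related to the
  -- whole graph, hence by maximality belongs to it, and is strictly related to itself.
  have ht₀ : inner ℝ x₀ u₀ ≤ t₀ := by
    by_contra! hlt
    have hpos : ∀ y, ∀ v ∈ A y, 0 < inner ℝ (x₀ - y) (u₀ - v) := by
      intro y v hv
      have h := hp₀ ⟨(y, v), hv⟩
      simp only [c, s, WithLp.prod_inner_apply] at h
      simp only [inner_sub_left, inner_sub_right]
      rw [real_inner_comm y u₀] at h
      linarith
    have := hpos x₀ u₀ (hmax _ _ fun y v hv => (hpos y v hv).le)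
    simp at this
  have hineq : ∀ y, ∀ v ∈ A y, ‖x₀ + u₀‖ ^ 2 ≤ inner ℝ (-u₀ - y) (-x₀ - v) := by
    intro y v hv
    have h := hsub _ _ (hgraph y v hv)
    simp only [inner_sub_left, WithLp.prod_inner_apply, real_inner_self_eq_norm_sq] at h
    have e := norm_add_sq_real x₀ u₀
    simp only [inner_sub_left, inner_sub_right, inner_neg_left, inner_neg_right]
    rw [real_inner_comm x₀ u₀, real_inner_comm v u₀]
    linarith
  have hmem := hmax (-u₀) (-x₀) fun y v hv => (sq_nonneg _).trans (hineq y v hv)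
  -- Testing `(-u₀, -x₀)` against itself makes the right-hand side zero, so `u₀ = -x₀`.
  have h0 := hineq _ _ hmem
  have hx : x₀ + u₀ = 0 := by simpa using h0
  refine ⟨x₀, ?_⟩
  rwa [← eq_neg_of_add_eq_zero_left hx] at hmem

/-- Minty's theorem: the resolvent of a maximal monotone operator is defined everywhere. -/
theorem MaximalMonotoneOp.sub_J_mem [CompleteSpace X] (hA : MaximalMonotoneOp A) (y : X) :
    y - J A y ∈ A (J A y) := by
  rw [← mem_resolventOp]
  obtain ⟨x, hx⟩ := (hA.translate y).exists_neg_mem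
  exact Classical.epsilon_spec (p := fun x => x ∈ resolventOp A y)
    ⟨x, mem_resolventOp.2 (by simpa [sub_eq_neg_add] using hx)⟩

/-- Firm nonexpansiveness, the source of both uniqueness and the Lipschitz bound for resolvents. -/
theorem MonotoneOp.sq_norm_sub_le (hA : MonotoneOp A) {x x' y y' : X} (h : y - x ∈ A x)
    (h' : y' - x' ∈ A x') : ‖x - x'‖ ^ 2 ≤ inner ℝ (x - x') (y - y') := by
  have := hA h h'
  rw [show y - x - (y' - x') = (y - y') - (x - x') by abel, inner_sub_right,
    real_inner_self_eq_norm_sq] at this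
  linarith

theorem MaximalMonotoneOp.J_eq [CompleteSpace X] (hA : MaximalMonotoneOp A) {x y : X}
    (h : y - x ∈ A x) : J A y = x := by
  have := hA.1.sq_norm_sub_le (hA.sub_J_mem y) h
  rw [← sub_eq_zero]
  simpa using this

theorem MaximalMonotoneOp.norm_J_sub_le [CompleteSpace X] (hA : MaximalMonotoneOp A) (y y' : X) :
    ‖J A y - J A y'‖ ≤ ‖y - y'‖ := by
  have h := (hA.1.sq_norm_sub_le (hA.sub_J_mem y) (hA.sub_J_mem y')).trans
    (real_inner_le_norm _ _)
  rcases (norm_nonneg (J A y - J A y')).eq_or_lt with h0 | h0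
  · rw [← h0]; exact norm_nonneg _
  · rw [sq] at h; exact le_of_mul_le_mul_left h h0

theorem Cocoercive.norm_sub_le {β : ℝ} (hβ : 0 < β) (hC : Cocoercive β C) (x y : X) :
    ‖C x - C y‖ ≤ β⁻¹ * ‖x - y‖ := by
  have h := (hC x y).trans (real_inner_le_norm _ _)
  rw [le_inv_mul_iff₀ hβ]
  rcases (norm_nonneg (C x - C y)).eq_or_lt with h0 | h0
  · rw [← h0, mul_zero]; exact norm_nonneg _
  · rw [sq, ← mul_assoc] at h; exact le_of_mul_le_mul_right h h0

/-- A pair `(x, u)` related to the graph is tested at `x + (β / 2) • (u - C x)`. As `C` is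
`β⁻¹`-Lipschitz, this move changes `C` by at most half of `‖u - C x‖`, which forces `u = C x`. -/
theorem Cocoercive.maximalMonotoneOp {β : ℝ} (hβ : 0 < β) (hC : Cocoercive β C) :
    MaximalMonotoneOp (ofMap C) := by
  rw [maximalMonotoneOp_iff]
  refine ⟨?_, fun x u h => ?_⟩
  · rintro x y _ _ rfl rfl
    exact (mul_nonneg hβ.le (sq_nonneg _)).trans (hC x y)
  · set d := u - C x with hd
    have h1 := h (x + (β / 2) • d) _ rfl
    have h2 := hC.norm_sub_le hβ x (x + (β / 2) • d)
    set w := C (x + (β / 2) • d)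
    have h3 := real_inner_le_norm d (-(C x - w))
    rw [sub_add_cancel_left, norm_neg, norm_smul, Real.norm_of_nonneg (by positivity)] at h2
    rw [sub_add_cancel_left, ← smul_neg, real_inner_smul_left,
      show u - w = d + (C x - w) by rw [hd]; abel] at h1
    have h4 := nonneg_of_mul_nonneg_right h1 (by positivity)
    rw [inner_neg_left, inner_add_right, real_inner_self_eq_norm_sq] at h4
    rw [norm_neg, inner_neg_right] at h3
    have h5 : ‖d‖ * ‖C x - w‖ ≤ ‖d‖ ^ 2 / 2 := by
      refine (mul_le_mul_of_nonneg_left h2 (norm_nonneg _)).trans (le_of_eq ?_)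
      field_simp
    have h6 : d = 0 := by
      rw [← norm_eq_zero, ← sq_eq_zero_iff]
      exact le_antisymm (by linarith) (sq_nonneg _)
    exact sub_eq_zero.1 h6

end Resolvent

/-! ### Weak convergence and weak compactness along ultrafilters -/

section WeakConvergence

variable {X : Type*} [NormedAddCommGroup X] [InnerProductSpace ℝ X] {ι : Type*} {l : Filter ι}
  {x y : ι → X} {v w : X} {M : ℝ}

/-- Weak convergence along a filter, tested against inner products. -/
def WeaklyConverges (l : Filter ι) (x : ι → X) (w : X) : Prop :=
  ∀ y, Tendsto (fun i => inner ℝ (x i) y) l (𝓝 (inner ℝ w y))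

theorem weakTendsto_iff [CompleteSpace X] {x : ℕ → X} :
    WeakTendsto x w ↔ WeaklyConverges atTop x w := by
  have hind : IsInducing fun (v : WeakSpace ℝ X) (f : StrongDual ℝ X) =>
    (topDualPairing ℝ X).flip v f := ⟨rfl⟩
  rw [WeakTendsto, hind.tendsto_nhds_iff, tendsto_pi_nhds]
  constructor
  · intro h y
    have := h (InnerProductSpace.toDual ℝ X y)
    simp only [real_inner_comm y]
    exact this
  · intro h f
    have := h ((InnerProductSpace.toDual ℝ X).symm f)
    simp only [real_inner_comm ((InnerProductSpace.toDual ℝ X).symm f),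
      InnerProductSpace.toDual_symm_apply] at this
    exact this

theorem WeaklyConverges.mono {l' : Filter ι} (hw : WeaklyConverges l x w) (h : l' ≤ l) :
    WeaklyConverges l' x w := fun y => (hw y).mono_left h

theorem WeaklyConverges.of_sub_tendsto_zero (hw : WeaklyConverges l x w)
    (h : Tendsto (fun i => y i - x i) l (𝓝 0)) : WeaklyConverges l y w := by
  intro v
  have := (hw v).add (h.inner (tendsto_const_nhds (x := v)))
  simpa [← inner_add_left] using this

theorem tendsto_inner_zero_of_norm_le (hM : ∀ i, ‖x i‖ ≤ M) (h : Tendsto y l (𝓝 0)) :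
    Tendsto (fun i => inner ℝ (x i) (y i)) l (𝓝 0) := by
  refine squeeze_zero_norm (a := fun i => M * ‖y i‖) (fun i => ?_) ?_
  · exact (norm_inner_le_norm _ _).trans (mul_le_mul_of_nonneg_right (hM i) (norm_nonneg _))
  · simpa using h.norm.const_mul M

theorem WeaklyConverges.inner_tendsto (hw : WeaklyConverges l x w) (hM : ∀ i, ‖x i‖ ≤ M)
    (h : Tendsto y l (𝓝 v)) : Tendsto (fun i => inner ℝ (x i) (y i)) l (𝓝 (inner ℝ w v)) := by
  have h0 := tendsto_inner_zero_of_norm_le hM (tendsto_sub_nhds_zero_iff.2 h)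
  simpa [inner_sub_right] using h0.add (hw v)

/-- Bounded families have weak limits along ultrafilters. -/
theorem exists_weaklyConverges [CompleteSpace X] (U : Ultrafilter ι) (hM : ∀ i, ‖x i‖ ≤ M) :
    ∃ w, WeaklyConverges U x w := by
  have hbd : ∀ y i, ‖(inner ℝ (x i) y : ℝ)‖ ≤ M * ‖y‖ := fun y i =>
    (norm_inner_le_norm _ _).trans (mul_le_mul_of_nonneg_right (hM i) (norm_nonneg _))
  have hex : ∀ y, ∃ a ∈ Metric.closedBall (0 : ℝ) (M * ‖y‖),
      Tendsto (fun i => inner ℝ (x i) y) U (𝓝 a) := fun y =>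
    (isCompact_closedBall (0 : ℝ) (M * ‖y‖)).ultrafilter_le_nhds
      (U.map fun i => inner ℝ (x i) y)
      (by
        rw [Ultrafilter.coe_map, le_principal_iff]
        exact mem_map.2 (univ_mem' fun i => mem_closedBall_zero_iff.2 (hbd y i)))
  choose f hfM hf using hex
  -- The ultrafilter limits depend linearly on the test vector, with bound `M`; Riesz representation
  -- supplies the weak limit.
  let F : X →ₗ[ℝ] ℝ :=
    { toFun := f
      map_add' := fun y z => tendsto_nhds_unique (hf (y + z))
        (by simpa [inner_add_right] using (hf y).add (hf z))
      map_smul' := fun c y => tendsto_nhds_unique (hf (c • y))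
        (by simpa [real_inner_smul_right] using (hf y).const_mul c) }
  refine ⟨(InnerProductSpace.toDual ℝ X).symm
    (F.mkContinuous M fun y => mem_closedBall_zero_iff.1 (hfM y)), fun y => ?_⟩
  rw [InnerProductSpace.toDual_symm_apply]
  exact hf y

/-- A bounded family with at most one weak cluster point converges weakly. -/
theorem weaklyConverges_of_forall_ultrafilter [CompleteSpace X] (hM : ∀ i, ‖x i‖ ≤ M)
    (h : ∀ (U : Ultrafilter ι) (v : X), ↑U ≤ l → WeaklyConverges U x v → v = w) :
    WeaklyConverges l x w := by
  intro y
  rw [tendsto_iff_ultrafilter]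
  intro U hU
  obtain ⟨v, hv⟩ := exists_weaklyConverges U hM
  exact h U v hU hv ▸ hv y

theorem WeaklyConverges.exists_norm_le [CompleteSpace X] {x : ℕ → X}
    (hw : WeaklyConverges atTop x w) : ∃ M, ∀ n, ‖x n‖ ≤ M := by
  obtain ⟨M, hM⟩ := banach_steinhaus (g := fun n => innerSL ℝ (x n)) fun y => by
    obtain ⟨c, hc⟩ := (hw y).norm.bddAbove_range
    exact ⟨c, fun n => hc ⟨n, rfl⟩⟩
  exact ⟨M, fun n => by simpa using hM n⟩

end WeakConvergence

/-! ### Krasnoselskii–Mann iteration of a nonexpansive map -/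

section KrasnoselskiiMann

variable {X : Type*} [NormedAddCommGroup X] [InnerProductSpace ℝ X] {N : X → X}

/-- Demiclosedness principle: `N - I` has a demiclosed graph at `0`. -/
theorem fixed_of_weaklyConverges {ι : Type*} {l : Filter ι} [l.NeBot] {x : ι → X} {w : X} {M : ℝ}
    (hN : LipschitzWith 1 N) (hM : ∀ i, ‖x i‖ ≤ M) (hw : WeaklyConverges l x w)
    (h : Tendsto (fun i => N (x i) - x i) l (𝓝 0)) : N w = w := by
  have hle : ∀ i, ‖w - N w‖ ^ 2 + 2 * inner ℝ (x i - w) (w - N w) ≤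
      ‖N (x i) - x i‖ ^ 2 + 2 * (M + ‖w‖) * ‖N (x i) - x i‖ := by
    intro i
    have h1 : ‖x i - N w‖ ≤ ‖N (x i) - x i‖ + ‖x i - w‖ := by
      have h2 : ‖N (x i) - N w‖ ≤ ‖x i - w‖ := by simpa using hN.norm_sub_le (x i) w
      calc ‖x i - N w‖ = ‖(N (x i) - N w) - (N (x i) - x i)‖ := by congr 1; abel
        _ ≤ ‖N (x i) - N w‖ + ‖N (x i) - x i‖ := norm_sub_le _ _
        _ ≤ _ := by linarith
    have h3 : ‖x i - w‖ ≤ M + ‖w‖ := (norm_sub_le _ _).trans (by linarith [hM i])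
    have h4 := norm_add_sq_real (x i - w) (w - N w)
    rw [sub_add_sub_cancel] at h4
    have h5 : ‖x i - N w‖ ^ 2 ≤ (‖N (x i) - x i‖ + ‖x i - w‖) ^ 2 :=
      pow_le_pow_left₀ (norm_nonneg _) h1 2
    have h6 := mul_le_mul_of_nonneg_right h3 (norm_nonneg (N (x i) - x i))
    linarith
  have hl : Tendsto (fun i => ‖w - N w‖ ^ 2 + 2 * inner ℝ (x i - w) (w - N w)) l
      (𝓝 (‖w - N w‖ ^ 2 + 2 * 0)) := by
    refine tendsto_const_nhds.add (Tendsto.const_mul 2 ?_)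
    have := (hw (w - N w)).sub_const (inner ℝ w (w - N w))
    simpa [inner_sub_left] using this
  have hr : Tendsto (fun i => ‖N (x i) - x i‖ ^ 2 + 2 * (M + ‖w‖) * ‖N (x i) - x i‖) l
      (𝓝 (‖(0 : X)‖ ^ 2 + 2 * (M + ‖w‖) * ‖(0 : X)‖)) :=
    (h.norm.pow 2).add (h.norm.const_mul _)
  have h0 := le_of_tendsto_of_tendsto' hl hr hle
  have h1 : ‖w - N w‖ ^ 2 ≤ 0 := by simpa using h0
  have h2 : w - N w = 0 := by
    rw [← norm_eq_zero, ← sq_eq_zero_iff]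
    exact le_antisymm h1 (sq_nonneg _)
  exact (sub_eq_zero.1 h2).symm

variable {μ : ℕ → ℝ} {z : ℕ → X}

/-- A nonexpansive map with a bounded Krasnoselskii–Mann orbit has a fixed point. -/
theorem exists_fixed_of_bounded_orbit [CompleteSpace X] (hN : LipschitzWith 1 N)
    (hμ : ∀ j, μ j ∈ Ioo 0 1) (hsum : Tendsto (fun n => ∑ j ∈ Finset.range n, μ j) atTop atTop)
    (hz : ∀ j, z (j + 1) = z j + μ j • (N (z j) - z j)) {R : ℝ} (hR : ∀ j, ‖z j‖ ≤ R) :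
    ∃ y, N y = y := by
  have hN' : ∀ a b, ‖N a - N b‖ ≤ ‖a - b‖ := fun a b => by simpa using hN.norm_sub_le a b
  set M := R + ‖N 0‖
  have hM : ∀ j, ‖N (z j)‖ ≤ M := by
    intro j
    have h1 := hN' (z j) 0
    rw [sub_zero] at h1
    have h2 := norm_le_norm_add_norm_sub' (N (z j)) (N 0)
    have h4 := hR j
    linarith
  -- approximate fixed points
  have hex : ∀ t : ℝ, 0 < t → t < 1 → ∃ x, (1 - t) • N x = x ∧ ‖x‖ ≤ R + M + 1 := by
    intro t ht0 ht1
    have hc : ContractingWith (1 - t).toNNReal fun x => (1 - t) • N x := by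
      refine ⟨by simpa using ht0, LipschitzWith.of_dist_le_mul fun a b => ?_⟩
      rw [Real.coe_toNNReal _ (by linarith), dist_eq_norm, dist_eq_norm, ← smul_sub, norm_smul, Real.norm_of_nonneg (by linarith)]
      exact mul_le_mul_of_nonneg_left (hN' a b) (by linarith)
    have hfix : (1 - t) • N (hc.fixedPoint) = hc.fixedPoint := hc.fixedPoint_isFixedPt
    refine ⟨hc.fixedPoint, hfix, ?_⟩
    generalize hc.fixedPoint = x at hfix
    -- With `x = (1 - t) N x`, each step contracts the excess of `‖z j - x‖` over `M` by the factor
    -- `1 - t * μ j`. Since `∑ μ j` diverges, the orbit comes within `M + 1` of `x`, so `‖x‖` is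
    -- bounded independently of `t`.
    have hstep : ∀ j, ‖z (j + 1) - x‖ - M ≤ (1 - t * μ j) * (‖z j - x‖ - M) := by
      intro j
      obtain ⟨h0, h1⟩ := hμ j
      have e1 : z (j + 1) - x = (1 - μ j) • (z j - x) + μ j • (N (z j) - x) := by
        rw [hz]; module
      have e2 : N (z j) - x = (1 - t) • (N (z j) - N x) + t • N (z j) := by
        conv_lhs => rw [← hfix]
        module
      have h2 : ‖N (z j) - x‖ ≤ (1 - t) * ‖z j - x‖ + t * M := by
        rw [e2]
        refine (norm_add_le _ _).trans ?_
        rw [norm_smul, norm_smul, Real.norm_of_nonneg ht0.le, Real.norm_of_nonneg (by linarith)]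
        exact add_le_add (mul_le_mul_of_nonneg_left (hN' _ _) (by linarith))
          (mul_le_mul_of_nonneg_left (hM j) ht0.le)
      have h3 : ‖z (j + 1) - x‖ ≤ (1 - μ j) * ‖z j - x‖ + μ j * ‖N (z j) - x‖ := by
        rw [e1]
        refine (norm_add_le _ _).trans ?_
        rw [norm_smul, norm_smul, Real.norm_of_nonneg h0.le, Real.norm_of_nonneg (by linarith)]
      have h4 := mul_le_mul_of_nonneg_left h2 h0.le
      linarith
    have hlt : ∃ n, ‖z n - x‖ < M + 1 := by
      by_contra! hcon
      have hdec : ∀ n, t * ∑ j ∈ Finset.range n, μ j ≤ ‖z 0 - x‖ - ‖z n - x‖ := by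
        intro n
        induction n with
        | zero => simp
        | succ n ih =>
          rw [Finset.sum_range_succ]
          have h1 := hstep n
          have h2 := mul_le_mul_of_nonneg_left (hcon n) (mul_pos ht0 (hμ n).1).le
          linarith
      obtain ⟨n, hn⟩ := (hsum.eventually_gt_atTop (‖z 0 - x‖ / t)).exists
      have h1 := hdec n
      rw [div_lt_iff₀ ht0] at hn
      have := norm_nonneg (z n - x)
      linarith
    obtain ⟨n, hn⟩ := hlt
    have h1 := norm_le_norm_add_norm_sub (z n) x
    have h2 := hR n
    linarith
  have ht : ∀ n : ℕ, (0 : ℝ) < 1 / (n + 2) ∧ (1 : ℝ) / (n + 2) < 1 := fun n =>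
    ⟨by positivity, by rw [div_lt_one (by positivity)]; linarith [n.cast_nonneg (α := ℝ)]⟩
  choose x hx hxM using fun n : ℕ => hex _ (ht n).1 (ht n).2
  have hlim : Tendsto (fun n => N (x n) - x n) atTop (𝓝 0) := by
    have h1 : Tendsto (fun n : ℕ => (1 : ℝ) / (n + 2)) atTop (𝓝 0) :=
      tendsto_const_nhds.div_atTop
        (tendsto_natCast_atTop_atTop.atTop_add tendsto_const_nhds)
    refine squeeze_zero_norm (a := fun n : ℕ => (1 : ℝ) / (n + 2) * (‖N 0‖ + (R + M + 1)))
      (fun n => ?_) (by simpa using h1.mul_const _)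
    have e : N (x n) - x n = (1 / ((n : ℝ) + 2)) • N (x n) := by
      conv_lhs => rw [← hx n, hx n]
      nth_rewrite 2 [← hx n]
      module
    rw [e, norm_smul, Real.norm_of_nonneg (ht n).1.le]
    refine mul_le_mul_of_nonneg_left ?_ (ht n).1.le
    have h2 := hN' (x n) 0
    rw [sub_zero] at h2
    have h3 := norm_le_norm_add_norm_sub' (N (x n)) (N 0)
    linarith [hxM n]
  obtain ⟨w, hw⟩ := exists_weaklyConverges (Ultrafilter.of (atTop : Filter ℕ)) hxM
  exact ⟨w, fixed_of_weaklyConverges hN hxM hw (hlim.mono_left (Ultrafilter.of_le _))⟩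

/-- Quantitative Fejér monotonicity: expand the square of the convex combination and use `‖N (z j) -
y‖ ≤ ‖z j - y‖`. -/
theorem sq_norm_sub_fixed_le (hN : LipschitzWith 1 N) (hμ : ∀ j, μ j ∈ Ioo 0 1)
    (hz : ∀ j, z (j + 1) = z j + μ j • (N (z j) - z j)) {y : X} (hy : N y = y) (j : ℕ) :
    ‖z (j + 1) - y‖ ^ 2 ≤ ‖z j - y‖ ^ 2 - μ j * (1 - μ j) * ‖N (z j) - z j‖ ^ 2 := by
  have h1 : ‖N (z j) - y‖ ^ 2 ≤ ‖z j - y‖ ^ 2 :=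
    pow_le_pow_left₀ (norm_nonneg _) (by simpa [hy] using hN.norm_sub_le (z j) y) 2
  have e1 : z (j + 1) - y = (z j - y) + μ j • (N (z j) - z j) := by rw [hz]; abel
  have e2 := norm_add_sq_real (z j - y) (μ j • (N (z j) - z j))
  have e3 := norm_add_sq_real (z j - y) (N (z j) - z j)
  rw [← e1, norm_smul, mul_pow, real_inner_smul_right, Real.norm_eq_abs, sq_abs] at e2
  rw [show z j - y + (N (z j) - z j) = N (z j) - y by abel] at e3
  have h2 := mul_le_mul_of_nonneg_left h1 (hμ j).1.le
  rw [e3] at h2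
  linarith

/-- The residuals of the Krasnoselskii–Mann iteration tend to zero. -/
theorem residual_tendsto_zero (hN : LipschitzWith 1 N) (hμ : ∀ j, μ j ∈ Ioo 0 1)
    (hsum : Tendsto (fun n => ∑ j ∈ Finset.range n, μ j * (1 - μ j)) atTop atTop)
    (hz : ∀ j, z (j + 1) = z j + μ j • (N (z j) - z j)) {y : X} (hy : N y = y) :
    Tendsto (fun j => N (z j) - z j) atTop (𝓝 0) := by
  -- Divergence of the sum only makes the residual small at some index; monotonicity carries this to
  -- all later ones.
  have hanti : Antitone fun j => ‖N (z j) - z j‖ := by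
    refine antitone_nat_of_succ_le fun j => ?_
    obtain ⟨h0, h1⟩ := hμ j
    have h2 : ‖N (z (j + 1)) - N (z j)‖ ≤ μ j * ‖N (z j) - z j‖ := by
      have := hN.norm_sub_le (z (j + 1)) (z j)
      rwa [hz j, add_sub_cancel_left, norm_smul, Real.norm_of_nonneg h0.le, NNReal.coe_one,
        one_mul, ← hz j] at this
    have e : N (z (j + 1)) - z (j + 1)
        = (N (z (j + 1)) - N (z j)) + (1 - μ j) • (N (z j) - z j) := by
      nth_rewrite 2 [hz j]; module
    have h3 := norm_add_le (N (z (j + 1)) - N (z j)) ((1 - μ j) • (N (z j) - z j))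
    rw [← e, norm_smul, Real.norm_of_nonneg (by linarith)] at h3
    linarith
  have hsumle : ∀ n, ∑ j ∈ Finset.range n, μ j * (1 - μ j) * ‖N (z j) - z j‖ ^ 2
      ≤ ‖z 0 - y‖ ^ 2 - ‖z n - y‖ ^ 2 := by
    intro n
    induction n with
    | zero => simp
    | succ n ih =>
      rw [Finset.sum_range_succ]
      linarith [sq_norm_sub_fixed_le hN hμ hz hy n]
  rw [tendsto_zero_iff_norm_tendsto_zero, Metric.tendsto_atTop]
  intro ε hε
  have hlt : ∃ n, ‖N (z n) - z n‖ < ε := by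
    by_contra! hcon
    obtain ⟨n, hn⟩ := (hsum.eventually_gt_atTop (‖z 0 - y‖ ^ 2 / ε ^ 2)).exists
    rw [div_lt_iff₀ (by positivity), Finset.sum_mul] at hn
    have h1 : ∑ j ∈ Finset.range n, μ j * (1 - μ j) * ε ^ 2
        ≤ ∑ j ∈ Finset.range n, μ j * (1 - μ j) * ‖N (z j) - z j‖ ^ 2 :=
      Finset.sum_le_sum fun j _ => mul_le_mul_of_nonneg_left
        (pow_le_pow_left₀ hε.le (hcon j) 2)
        (mul_nonneg (hμ j).1.le (by linarith [(hμ j).2]))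
    linarith [hsumle n, sq_nonneg ‖z n - y‖]
  obtain ⟨n, hn⟩ := hlt
  refine ⟨n, fun m hm => ?_⟩
  rw [dist_zero_right, norm_norm]
  exact (hanti hm).trans_lt hn

theorem antitone_norm_sub_fixed (hN : LipschitzWith 1 N) (hμ : ∀ j, μ j ∈ Ioo 0 1)
    (hz : ∀ j, z (j + 1) = z j + μ j • (N (z j) - z j)) {y : X} (hy : N y = y) :
    Antitone fun j => ‖z j - y‖ := by
  refine antitone_nat_of_succ_le fun j => le_of_sq_le_sq ?_ (norm_nonneg _)
  have h := sq_norm_sub_fixed_le hN hμ hz hy j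
  have := mul_nonneg (mul_nonneg (hμ j).1.le (by linarith [(hμ j).2] : 0 ≤ 1 - μ j))
    (sq_nonneg ‖N (z j) - z j‖)
  linarith

/-- Weak convergence of the Krasnoselskii–Mann iteration. -/
theorem exists_weaklyConverges_fixed [CompleteSpace X] (hN : LipschitzWith 1 N)
    (hμ : ∀ j, μ j ∈ Ioo 0 1)
    (hsum : Tendsto (fun n => ∑ j ∈ Finset.range n, μ j * (1 - μ j)) atTop atTop)
    (hz : ∀ j, z (j + 1) = z j + μ j • (N (z j) - z j)) {y : X} (hy : N y = y) :
    ∃ w, N w = w ∧ WeaklyConverges atTop z w := by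
  have hM : ∀ j, ‖z j‖ ≤ ‖z 0 - y‖ + ‖y‖ := fun j => by
    have h1 := antitone_norm_sub_fixed hN hμ hz hy (Nat.zero_le j)
    have h2 := norm_le_norm_add_norm_sub' (z j) y
    simp only at h1
    linarith
  have hres := residual_tendsto_zero hN hμ hsum hz hy
  have hfix : ∀ (U : Ultrafilter ℕ) (v : X), ↑U ≤ (atTop : Filter ℕ) →
      WeaklyConverges U z v → N v = v := fun U v hU hv =>
    fixed_of_weaklyConverges hN hM hv (hres.mono_left hU)
  have hconv : ∀ v, N v = v → ∃ r, Tendsto (fun j => ‖z j - v‖ ^ 2) atTop (𝓝 r) := fun v hv =>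
    ⟨_, (tendsto_atTop_ciInf (antitone_norm_sub_fixed hN hμ hz hv)
      ⟨0, by rintro _ ⟨j, rfl⟩; exact norm_nonneg _⟩).pow 2⟩
  obtain ⟨w, hw⟩ := exists_weaklyConverges (Ultrafilter.of (atTop : Filter ℕ)) hM
  have hwN := hfix _ w (Ultrafilter.of_le _) hw
  refine ⟨w, hwN, weaklyConverges_of_forall_ultrafilter hM fun U v hU hv => ?_⟩
  obtain ⟨r, hr⟩ := hconv w hwN
  obtain ⟨r', hr'⟩ := hconv v (hfix U v hU hv)
  -- Opial's argument: distances to `v` and `w` both converge, hence so does `⟪z j, v - w⟫`, and its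
  -- limit is the same along both ultrafilters.
  have hdiff : Tendsto (fun j => inner ℝ (z j) (v - w)) atTop
      (𝓝 ((r - r' - ‖w‖ ^ 2 + ‖v‖ ^ 2) / 2)) := by
    refine ((((hr.sub hr').sub_const (‖w‖ ^ 2)).add_const (‖v‖ ^ 2)).div_const 2).congr
      fun j => ?_
    rw [norm_sub_sq_real, norm_sub_sq_real, inner_sub_right]
    ring
  have e1 := tendsto_nhds_unique (hv (v - w)) (hdiff.mono_left hU)
  have e2 := tendsto_nhds_unique (hw (v - w)) (hdiff.mono_left (Ultrafilter.of_le _))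
  have e3 : inner ℝ (v - w) (v - w) = 0 := by rw [inner_sub_left, e1, e2, sub_self]
  exact sub_eq_zero.1 (inner_self_eq_zero.1 e3)

end KrasnoselskiiMann

/-! ### From uniform monotonicity to strong convergence -/

section UniformMonotonicity

variable {X : Type*} [NormedAddCommGroup X] [InnerProductSpace ℝ X]

/-- Uniform monotonicity on bounded sets turns a vanishing monotonicity gap into strong
convergence. -/
theorem UniformlyMonotoneOnBounded.tendsto_of_inner_le {M : X → Set X}
    (hM : UniformlyMonotoneOnBounded M) {γ : ℝ} (hγ : 0 < γ) {xs us : ℕ → X} {x u : X} {R : ℝ}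
    (hR : ∀ n, ‖xs n‖ ≤ R) (hus : ∀ n, us n ∈ (γ • M) (xs n)) (hu : u ∈ (γ • M) x) {e : ℕ → ℝ}
    (he : Tendsto e atTop (𝓝 0)) (hle : ∀ n, inner ℝ (xs n - x) (us n - u) ≤ e n) :
    Tendsto xs atTop (𝓝 x) := by
  choose vs hvs hvus using hus
  obtain ⟨v, hv, rfl⟩ := hu
  have hbdd : Bornology.IsBounded (insert x (range xs)) :=
    (isBounded_iff_forall_norm_le.2 ⟨R, by rintro _ ⟨n, rfl⟩; exact hR n⟩).insert x
  obtain ⟨φ, hmono, hzero, hφ⟩ := hM _ (insert_nonempty _ _) hbdd (by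
    rintro _ (rfl | ⟨n, rfl⟩)
    exacts [⟨v, hv⟩, ⟨vs n, hvs n⟩])
  rw [Metric.tendsto_atTop']
  intro ε hε
  have hpos : 0 < φ ε.toNNReal := by
    rw [pos_iff_ne_zero, Ne, hzero, Real.toNNReal_eq_zero, not_le]
    exact hε
  -- The modulus may be infinite at `ε`, so a finite positive value below it is used.
  obtain ⟨c, hc0, hc⟩ := ENNReal.lt_iff_exists_nnreal_btwn.1 hpos
  have hc0' : (0 : ℝ) < c := by exact_mod_cast hc0
  obtain ⟨n₀, hn₀⟩ := eventually_atTop.1 (he.eventually_lt_const (mul_pos hγ hc0'))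
  refine ⟨n₀, fun n hn => ?_⟩
  rw [dist_eq_norm]
  by_contra! hcon
  have h1 := hφ (xs n) (mem_insert_of_mem _ ⟨n, rfl⟩) x (mem_insert _ _) _ (hvs n) _ hv
  have h2 : (c : ℝ≥0∞) ≤ φ ‖xs n - x‖₊ :=
    hc.le.trans (hmono (Real.toNNReal_le_iff_le_coe.2 hcon))
  have h3 : ((c : ℝ) : EReal) ≤ ((inner ℝ (xs n - x) (vs n - v) : ℝ) : EReal) :=
    (EReal.coe_ennreal_le_coe_ennreal_iff.2 h2).trans h1
  have h4 := EReal.coe_le_coe_iff.1 h3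
  have h5 := hle n
  rw [← hvus n] at h5
  simp only [← smul_sub, real_inner_smul_right] at h5
  have h6 := mul_le_mul_of_nonneg_left h4 hγ.le
  linarith [hn₀ n hn.le]

end UniformMonotonicity

/-! ### The three-operator splitting and its shadow sequences -/

section Splitting

variable {X : Type*} [NormedAddCommGroup X] [InnerProductSpace ℝ X] {A B : X → Set X} {C : X → X}
  {β γ : ℝ}

/-- The point `z = x + γ v`, with `v ∈ B x` the `B`-component of the inclusion, is the fixed point
of `T` attached to the zero `x`. -/
theorem mem_zer_iff (hγ : γ ≠ 0) {x : X} : x ∈ zer (A + B + ofMap C) ↔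
    ∃ z, z - x ∈ (γ • B) x ∧ x - z - γ • C x ∈ (γ • A) x := by
  constructor
  · rintro ⟨_, ⟨u, hu, v, hv, rfl⟩, _, rfl, h⟩
    refine ⟨x + γ • v, ⟨v, hv, by simp⟩, ⟨u, hu, ?_⟩⟩
    have : u = -(v + C x) := eq_neg_of_add_eq_zero_left (by rw [← add_assoc]; exact h)
    simp only [this]
    module
  · rintro ⟨z, ⟨v, hv, hv'⟩, ⟨u, hu, hu'⟩⟩
    refine ⟨u + v, ⟨u, hu, v, hv, rfl⟩, C x, rfl, ?_⟩
    have h : γ • (u + v + C x) = 0 := by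
      simp only at hv' hu'
      rw [smul_add, smul_add, hv', hu']
      abel
    exact (smul_eq_zero.1 h).resolve_left hγ

variable [CompleteSpace X]

theorem sub_stepB_mem (hB : MaximalMonotoneOp B) (hγ : 0 < γ) (z : X) :
    z - stepB γ B z ∈ (γ • B) (stepB γ B z) := (hB.smul hγ).sub_J_mem z

theorem sub_stepA_mem (hA : MaximalMonotoneOp A) (hγ : 0 < γ) (z : X) :
    (2 : ℝ) • stepB γ B z - z - γ • C (stepB γ B z) - stepA γ A B C z ∈
      (γ • A) (stepA γ A B C z) := (hA.smul hγ).sub_J_mem _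

theorem stepC_add (hβ : 0 < β) (hC : Cocoercive β C) (hγ : 0 < γ) (z : X) :
    stepC γ A B C z + γ • C (stepC γ A B C z) = stepA γ A B C z + γ • C (stepB γ B z) := by
  obtain ⟨_, rfl, h⟩ := ((hC.maximalMonotoneOp hβ).smul hγ).sub_J_mem
    (stepA γ A B C z + γ • C (stepB γ B z))
  exact add_eq_of_eq_sub' h

theorem steps_eq (hA : MaximalMonotoneOp A) (hB : MaximalMonotoneOp B) (hβ : 0 < β)
    (hC : Cocoercive β C) (hγ : 0 < γ) {x z : X} (hz : z - x ∈ (γ • B) x)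
    (hz' : x - z - γ • C x ∈ (γ • A) x) : stepB γ B z = x ∧ splitT γ A B C z = z := by
  have h1 : stepB γ B z = x := (hB.smul hγ).J_eq hz
  have h2 : stepA γ A B C z = x := by
    refine (hA.smul hγ).J_eq ?_
    rw [h1]
    convert hz' using 1
    module
  have h3 : stepC γ A B C z = x := by
    refine ((hC.maximalMonotoneOp hβ).smul hγ).J_eq ⟨C x, rfl, ?_⟩
    simp only [h1, h2]
    abel
  exact ⟨h1, by rw [splitT, h1, h3]; abel⟩

theorem mem_of_splitT_eq (hA : MaximalMonotoneOp A) (hβ : 0 < β)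
    (hC : Cocoercive β C) (hγ : 0 < γ) {z : X} (hz : splitT γ A B C z = z) :
    stepB γ B z - z - γ • C (stepB γ B z) ∈ (γ • A) (stepB γ B z) := by
  have h1 : stepC γ A B C z = stepB γ B z := by
    rw [splitT, add_sub_left_comm] at hz
    exact sub_eq_zero.1 (by simpa using hz)
  have h2 := stepC_add (A := A) (B := B) hβ hC hγ z
  rw [h1] at h2
  have h3 := sub_stepA_mem (B := B) (C := C) hA hγ z
  rw [← add_right_cancel h2] at h3
  convert h3 using 1
  module

/-- The equation defining `x_C` gives `x_A - x_B = (x_C - x_B) + γ (C x_C - C x_B)`, and `C` is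
Lipschitz. -/
theorem stepA_sub_stepB_tendsto (hβ : 0 < β) (hC : Cocoercive β C) (hγ : 0 < γ) {z : ℕ → X}
    (hres : Tendsto (fun j => stepC γ A B C (z j) - stepB γ B (z j)) atTop (𝓝 0)) :
    Tendsto (fun j => stepA γ A B C (z j) - stepB γ B (z j)) atTop (𝓝 0) := by
  have h1 : Tendsto (fun j => C (stepC γ A B C (z j)) - C (stepB γ B (z j))) atTop (𝓝 0) :=
    squeeze_zero_norm (fun j => hC.norm_sub_le hβ _ _) (by simpa using hres.norm.const_mul β⁻¹)
  have h2 := hres.add (h1.const_smul γ)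
  rw [smul_zero, add_zero] at h2
  refine h2.congr fun j => ?_
  have h3 := stepC_add (A := A) (B := B) hβ hC hγ (z j)
  rw [smul_sub, eq_sub_of_add_eq h3.symm]
  abel

theorem norm_stepB_le (hB : MaximalMonotoneOp B) (hγ : 0 < γ) {R : ℝ} {z : ℕ → X}
    (hR : ∀ j, ‖z j‖ ≤ R) (j : ℕ) : ‖stepB γ B (z j)‖ ≤ R + ‖stepB γ B 0‖ := by
  have h1 := (hB.smul hγ).norm_J_sub_le (z j) 0
  have h2 := norm_le_norm_add_norm_sub' (stepB γ B (z j)) (stepB γ B 0)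
  rw [sub_zero] at h1
  have h3 := hR j
  unfold stepB at h2 ⊢
  linarith

/-- Along a bounded sequence with vanishing residual, the monotonicity gaps of the three operators
with respect to a solution vanish. -/
theorem exists_gap_bound (hB : MaximalMonotoneOp B) (hβ : 0 < β)
    (hC : Cocoercive β C) (hγ : 0 < γ) {R : ℝ} {z : ℕ → X} (hR : ∀ j, ‖z j‖ ≤ R)
    (hres : Tendsto (fun j => stepC γ A B C (z j) - stepB γ B (z j)) atTop (𝓝 0)) (x z' : X) :
    ∃ e : ℕ → ℝ, Tendsto e atTop (𝓝 0) ∧ ∀ j,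
      γ * (β * ‖C (stepB γ B (z j)) - C x‖ ^ 2) +
        inner ℝ (stepB γ B (z j) - x) (z j - stepB γ B (z j) - (z' - x)) +
        inner ℝ (stepA γ A B C (z j) - x)
          ((2 : ℝ) • stepB γ B (z j) - z j - γ • C (stepB γ B (z j)) - stepA γ A B C (z j) -
            (x - z' - γ • C x)) ≤ e j := by
  have hd := stepA_sub_stepB_tendsto hβ hC hγ hres
  have hp := norm_stepB_le hB hγ hR
  set p := fun j => stepB γ B (z j)
  set q := fun j => stepA γ A B C (z j)
  have hbd : ∀ j, ‖z' - z j - γ • (C (p j) - C x)‖ ≤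
      ‖z'‖ + R + γ * (β⁻¹ * (R + ‖stepB γ B 0‖ + ‖x‖)) := by
    intro j
    refine (norm_sub_le _ _).trans (add_le_add ((norm_sub_le _ _).trans ?_) ?_)
    · linarith [hR j]
    · rw [norm_smul, Real.norm_of_nonneg hγ.le]
      gcongr
      refine (hC.norm_sub_le hβ _ _).trans ?_
      gcongr
      exact (norm_sub_le _ _).trans (by linarith [hp j])
  refine ⟨fun j => inner ℝ (z' - z j - γ • (C (p j) - C x)) (q j - p j) - ‖q j - p j‖ ^ 2, ?_,
    fun j => ?_⟩
  · simpa using (tendsto_inner_zero_of_norm_le hbd hd).sub (hd.norm.pow 2)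
  · have h1 := mul_le_mul_of_nonneg_left (hC (p j) x) hγ.le
    -- Every remaining term except the cocoercivity gap carries a factor `Q - P`, which tends to
    -- zero.
    have key : ∀ P Q Z c c' : X, inner ℝ (P - x) (Z - P - (z' - x)) +
        inner ℝ (Q - x) ((2 : ℝ) • P - Z - γ • c - Q - (x - z' - γ • c')) =
        inner ℝ (z' - Z - γ • (c - c')) (Q - P) - ‖Q - P‖ ^ 2
          - γ * inner ℝ (P - x) (c - c') := by
      intro P Q Z c c'
      obtain ⟨D, rfl⟩ : ∃ D, Q = P + D := ⟨Q - P, by abel⟩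
      obtain ⟨Y, rfl⟩ : ∃ Y, P = x + Y := ⟨P - x, by abel⟩
      obtain ⟨W, rfl⟩ : ∃ W, Z = z' + W := ⟨Z - z', by abel⟩
      obtain ⟨b, rfl⟩ : ∃ b, c = c' + b := ⟨c - c', by abel⟩
      rw [show x + Y - x = Y by abel, show x + Y + D - x = Y + D by abel,
        show x + Y + D - (x + Y) = D by abel, show c' + b - c' = b by abel,
        show z' + W - (x + Y) - (z' - x) = W - Y by abel,
        show z' - (z' + W) - γ • b = -W - γ • b by abel,
        show (2 : ℝ) • (x + Y) - (z' + W) - γ • (c' + b) - (x + Y + D) - (x - z' - γ • c')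
          = Y - W - γ • b - D by module, ← real_inner_self_eq_norm_sq]
      simp only [inner_sub_left, inner_sub_right, inner_add_left, inner_neg_left,
        real_inner_smul_left, real_inner_smul_right, real_inner_comm Y D, real_inner_comm W D,
        real_inner_comm b D]
      ring
    have h2 := key (p j) (q j) (z j) (C (p j)) (C x)
    simp only [p, q] at h1 h2 ⊢
    linarith

theorem tendsto_C_stepB (hA : MaximalMonotoneOp A) (hB : MaximalMonotoneOp B) (hβ : 0 < β)
    (hC : Cocoercive β C) (hγ : 0 < γ) {R : ℝ} {z : ℕ → X} (hR : ∀ j, ‖z j‖ ≤ R)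
    (hres : Tendsto (fun j => stepC γ A B C (z j) - stepB γ B (z j)) atTop (𝓝 0)) {x : X}
    (hx : x ∈ zer (A + B + ofMap C)) :
    Tendsto (fun j => C (stepB γ B (z j))) atTop (𝓝 (C x)) := by
  obtain ⟨z', hz', hz''⟩ := (mem_zer_iff hγ.ne').1 hx
  obtain ⟨e, he, hle⟩ := exists_gap_bound hB hβ hC hγ hR hres x z'
  have h1 : Tendsto (fun j => ‖C (stepB γ B (z j)) - C x‖ ^ 2) atTop (𝓝 0) := by
    refine squeeze_zero (g := fun j => (γ * β)⁻¹ * e j) (fun j => sq_nonneg _) (fun j => ?_)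
      (by simpa using he.const_mul (γ * β)⁻¹)
    rw [le_inv_mul_iff₀ (mul_pos hγ hβ)]
    have h2 := (hB.smul hγ).1 (sub_stepB_mem hB hγ (z j)) hz'
    have h3 := (hA.smul hγ).1 (sub_stepA_mem (B := B) (C := C) hA hγ (z j)) hz''
    linarith [hle j]
  rw [tendsto_iff_norm_sub_tendsto_zero]
  simpa using h1.sqrt

/-- Weak limits of the shadow sequence along an ultrafilter. -/
theorem mem_of_weaklyConverges_stepB (hA : MaximalMonotoneOp A) (hB : MaximalMonotoneOp B)
    (hβ : 0 < β) (hC : Cocoercive β C) (hγ : 0 < γ) {R : ℝ} {z : ℕ → X} (hR : ∀ j, ‖z j‖ ≤ R)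
    (hres : Tendsto (fun j => stepC γ A B C (z j) - stepB γ B (z j)) atTop (𝓝 0)) {x₀ : X}
    (hx₀ : x₀ ∈ zer (A + B + ofMap C)) {l : Filter ℕ} [l.NeBot] (hl : l ≤ atTop) {zs v : X}
    (hzs : WeaklyConverges l z zs) (hv : WeaklyConverges l (fun j => stepB γ B (z j)) v) :
    zs - v ∈ (γ • B) v ∧ v - zs - γ • C v ∈ (γ • A) v := by
  have hd := (stepA_sub_stepB_tendsto hβ hC hγ hres).mono_left hl
  have hp := norm_stepB_le hB hγ hR
  have hCp := (tendsto_C_stepB hA hB hβ hC hγ hR hres hx₀).mono_left hl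
  set p := fun j => stepB γ B (z j)
  set q := fun j => stepA γ A B C (z j)
  -- The graph of a maximal monotone operator is closed for weak convergence of points and strong
  -- convergence of values.
  have hCv : C v = C x₀ := by
    refine ((maximalMonotoneOp_iff.1 (hC.maximalMonotoneOp hβ)).2 v (C x₀) ?_).symm
    rintro y _ rfl
    have h1 : Tendsto (fun j => inner ℝ (p j - y) (C (p j) - C y)) l
        (𝓝 (inner ℝ (v - y) (C x₀ - C y))) := by
      have h2 := hv.inner_tendsto hp (hCp.sub_const (C y))
      have h3 := (tendsto_const_nhds (x := y)).inner (hCp.sub_const (C y)) (𝕜 := ℝ)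
      simpa only [inner_sub_left] using h2.sub h3
    exact ge_of_tendsto' h1 fun j => (mul_nonneg hβ.le (sq_nonneg _)).trans (hC _ _)
  rw [← hCv] at hCp
  have hgap : ∀ x, ∀ u ∈ (γ • B) x, ∀ y, ∀ w ∈ (γ • A) y,
      0 ≤ inner ℝ (v - x) (zs - v - u) + inner ℝ (v - y) (v - zs - γ • C v - w) := by
    intro x u hu y w hw
    -- In the sum, `‖P‖²` and `⟪P, Z⟫` cancel. The first group is linear in the weak limits or pairs
    -- them with the strongly convergent `c`; the second vanishes with `Q - P`.
    have key : ∀ P Q Z c : X, inner ℝ (P - x) (Z - P - u) +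
        inner ℝ (Q - y) ((2 : ℝ) • P - Z - γ • c - Q - w) =
        (inner ℝ P (x - y - u - w) - inner ℝ Z (x - y) - γ * inner ℝ P c + γ * inner ℝ y c
          + inner ℝ x u + inner ℝ y w) +
        (inner ℝ (y - w) (Q - P) - inner ℝ Z (Q - P) - γ * inner ℝ c (Q - P)
          - ‖Q - P‖ ^ 2) := by
      intro P Q Z c
      obtain ⟨D, rfl⟩ : ∃ D, Q = P + D := ⟨Q - P, by abel⟩
      rw [show P + D - P = D by abel, show (2 : ℝ) • P - Z - γ • c - (P + D) - w
          = P - Z - γ • c - D - w by module, ← real_inner_self_eq_norm_sq]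
      simp only [inner_sub_left, inner_sub_right, inner_add_left,
        real_inner_smul_right, real_inner_comm P D, real_inner_comm Z D,
        real_inner_comm c D, real_inner_comm w D, real_inner_comm x P, real_inner_comm y P,
        real_inner_comm x Z, real_inner_comm y Z]
      ring
    have hlim1 := ((((hv (x - y - u - w)).sub (hzs (x - y))).sub
      ((hv.inner_tendsto hp hCp).const_mul γ)).add
      (((tendsto_const_nhds (x := y)).inner hCp (𝕜 := ℝ)).const_mul γ)).add_const
        (inner ℝ x u) |>.add_const (inner ℝ y w)
    have hlim2 := ((((tendsto_const_nhds (x := y - w)).inner hd (𝕜 := ℝ)).sub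
      (tendsto_inner_zero_of_norm_le hR hd)).sub ((hCp.inner hd (𝕜 := ℝ)).const_mul γ)).sub
        (hd.norm.pow 2)
    have h0 := ge_of_tendsto' (hlim1.add hlim2) (b := 0) fun j => by
      have e := key (p j) (q j) (z j) (C (p j))
      have h1 := (hB.smul hγ).1 (sub_stepB_mem hB hγ (z j)) hu
      have h2 := (hA.smul hγ).1 (sub_stepA_mem (B := B) (C := C) hA hγ (z j)) hw
      exact (add_nonneg h1 h2).trans_eq e
    have e := key v v zs (C v)
    rw [show (2 : ℝ) • v - zs - γ • C v - v - w = v - zs - γ • C v - w by module] at e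
    rw [e]
    simpa using h0
  have hBmax := (maximalMonotoneOp_iff.1 (hB.smul hγ)).2
  have hAmax := (maximalMonotoneOp_iff.1 (hA.smul hγ)).2
  -- The two gaps in `hgap` vary independently. A negative `B`-gap would make every `A`-gap strictly
  -- positive, yet maximality then places the limit pair in the graph of `γ • A`, where its own gap
  -- is zero.
  have hmemB : zs - v ∈ (γ • B) v := by
    by_contra hcon
    obtain ⟨x, u, hu, hneg⟩ : ∃ x u, u ∈ (γ • B) x ∧ inner ℝ (v - x) (zs - v - u) < 0 := by
      by_contra! hall
      exact hcon (hBmax _ _ fun y w hw => hall y w hw)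
    have hpos : ∀ y, ∀ w ∈ (γ • A) y, 0 < inner ℝ (v - y) (v - zs - γ • C v - w) :=
      fun y w hw => by linarith [hgap x u hu y w hw]
    have h0 := hpos v _ (hAmax _ _ fun y w hw => (hpos y w hw).le)
    simp at h0
  exact ⟨hmemB, hAmax _ _ fun y w hw => by simpa using hgap v _ hmemB y w hw⟩

/-- Any weak cluster point `v` satisfies `zs - v ∈ γ B v`, so it can only be `J_{γB} zs`. -/
theorem weaklyConverges_stepB (hA : MaximalMonotoneOp A) (hB : MaximalMonotoneOp B)
    (hβ : 0 < β) (hC : Cocoercive β C) (hγ : 0 < γ) {R : ℝ} {z : ℕ → X} (hR : ∀ j, ‖z j‖ ≤ R)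
    (hres : Tendsto (fun j => stepC γ A B C (z j) - stepB γ B (z j)) atTop (𝓝 0)) {x₀ : X}
    (hx₀ : x₀ ∈ zer (A + B + ofMap C)) {zs : X} (hzs : WeaklyConverges atTop z zs) :
    stepB γ B zs ∈ zer (A + B + ofMap C) ∧
      WeaklyConverges atTop (fun j => stepB γ B (z j)) (stepB γ B zs) := by
  have hp := norm_stepB_le hB hγ hR
  have hU : ∀ (U : Ultrafilter ℕ) (v : X), ↑U ≤ (atTop : Filter ℕ) →
      WeaklyConverges U (fun j => stepB γ B (z j)) v →
      zs - v ∈ (γ • B) v ∧ v - zs - γ • C v ∈ (γ • A) v := fun U v hU hv =>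
    mem_of_weaklyConverges_stepB hA hB hβ hC hγ hR hres hx₀ hU (hzs.mono hU) hv
  refine ⟨?_, weaklyConverges_of_forall_ultrafilter hp fun U v hUl hv =>
    ((hB.smul hγ).J_eq (hU U v hUl hv).1).symm⟩
  obtain ⟨v, hv⟩ := exists_weaklyConverges (Ultrafilter.of (atTop : Filter ℕ)) hp
  have h := hU _ v (Ultrafilter.of_le _) hv
  rw [show stepB γ B zs = v from (hB.smul hγ).J_eq h.1]
  exact (mem_zer_iff hγ.ne').2 ⟨zs, h⟩

theorem tendsto_stepB (hA : MaximalMonotoneOp A) (hB : MaximalMonotoneOp B)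
    (hβ : 0 < β) (hC : Cocoercive β C) (hγ : 0 < γ) {R : ℝ} {z : ℕ → X} (hR : ∀ j, ‖z j‖ ≤ R)
    (hres : Tendsto (fun j => stepC γ A B C (z j) - stepB γ B (z j)) atTop (𝓝 0)) {x : X}
    (hx : x ∈ zer (A + B + ofMap C))
    (hweak : WeaklyConverges atTop (fun j => stepB γ B (z j)) x)
    (h : UniformlyMonotoneOnBounded A ∨ UniformlyMonotoneOnBounded B ∨
      ∀ x ∈ zer (A + B + ofMap C), DemiregularAt (ofMap C) x) :
    Tendsto (fun j => stepB γ B (z j)) atTop (𝓝 x) := by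
  have hd := stepA_sub_stepB_tendsto hβ hC hγ hres
  have hp := norm_stepB_le hB hγ hR
  obtain ⟨z', hz', hz''⟩ := (mem_zer_iff hγ.ne').1 hx
  obtain ⟨e, he, hle⟩ := exists_gap_bound hB hβ hC hγ hR hres x z'
  have hgC : ∀ j, 0 ≤ γ * (β * ‖C (stepB γ B (z j)) - C x‖ ^ 2) := fun j => by positivity
  have hgB := fun j => (hB.smul hγ).1 (sub_stepB_mem hB hγ (z j)) hz'
  have hgA := fun j => (hA.smul hγ).1 (sub_stepA_mem (B := B) (C := C) hA hγ (z j)) hz''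
  rcases h with h | h | h
  · obtain ⟨D, hD⟩ := hd.norm.bddAbove_range
    have hq : ∀ j, ‖stepA γ A B C (z j)‖ ≤ R + ‖stepB γ B 0‖ + D := fun j =>
      (norm_le_norm_add_norm_sub' _ _).trans (add_le_add (hp j) (hD ⟨j, rfl⟩))
    have h1 := h.tendsto_of_inner_le hγ hq (fun j => sub_stepA_mem hA hγ (z j)) hz'' he
      fun j => by linarith [hle j, hgC j, hgB j]
    simpa using h1.sub hd
  · exact h.tendsto_of_inner_le hγ hp (fun j => sub_stepB_mem hB hγ (z j)) hz' he
      fun j => by linarith [hle j, hgC j, hgA j]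
  · exact h x hx (C x) rfl _ _ (fun _ => rfl) (weakTendsto_iff.2 hweak)
      (tendsto_C_stepB hA hB hβ hC hγ hR hres hx)

end Splitting

end ThreeOp

/-! ### The convergence theorem -/

theorem mainTheorem1 {X : Type*} [NormedAddCommGroup X] [InnerProductSpace ℝ X] [CompleteSpace X]
    (A B : X → Set X) (C : X → X) (β γ a : ℝ)
    (hA : ThreeOp.MaximalMonotoneOp A) (hB : ThreeOp.MaximalMonotoneOp B)
    (hβ : 0 < β) (hC : ThreeOp.Cocoercive β C)
    (hγ : 0 < γ) (hγβ : γ ≤ 2 * β)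
    (ha : a = 2 * β / (4 * β - γ)) (ha1 : a < 1)
    (hT : ThreeOp.Averaged a (ThreeOp.splitT γ A B C))
    (lam : ℕ → ℝ) (hlam : ∀ j, lam j ∈ Set.Ioo 0 (1 / a))
    (hsum : Tendsto (fun n => ∑ j ∈ Finset.range n, a * lam j * (1 - a * lam j)) atTop atTop)
    (z : ℕ → X)
    (hz : ∀ j, z (j + 1) =
      z j + lam j • (ThreeOp.stepC γ A B C (z j) - ThreeOp.stepB γ B (z j))) :
    -- if the inclusion is solvable, the iterates have a weak limit, which is a fixed point of `T`
    ((ThreeOp.zer (A + B + ThreeOp.ofMap C)).Nonempty →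
      ∃ zs : X, ThreeOp.splitT γ A B C zs = zs ∧ ThreeOp.WeakTendsto z zs) ∧
    -- part 1
    (0 < ⨅ j, lam j → ∀ zs : X, ThreeOp.WeakTendsto z zs →
      (∀ xs ∈ ThreeOp.zer (A + B + ThreeOp.ofMap C),
        Tendsto (fun j => C (ThreeOp.stepB γ B (z j))) atTop (𝓝 (C xs))) ∧
      ThreeOp.J (γ • B) zs ∈ ThreeOp.zer (A + B + ThreeOp.ofMap C) ∧
      ThreeOp.WeakTendsto (fun j => ThreeOp.stepB γ B (z j)) (ThreeOp.J (γ • B) zs) ∧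
      ThreeOp.WeakTendsto (fun j => ThreeOp.stepA γ A B C (z j)) (ThreeOp.J (γ • B) zs) ∧
      ThreeOp.WeakTendsto (fun j => ThreeOp.stepC γ A B C (z j)) (ThreeOp.J (γ • B) zs)) ∧
    -- part 2
    ((ThreeOp.zer (A + B + ThreeOp.ofMap C)).Nonempty →
      (ThreeOp.UniformlyMonotoneOnBounded A ∨ ThreeOp.UniformlyMonotoneOnBounded B ∨
        ∀ x ∈ ThreeOp.zer (A + B + ThreeOp.ofMap C), ThreeOp.DemiregularAt (ThreeOp.ofMap C) x) →
      ∃ x ∈ ThreeOp.zer (A + B + ThreeOp.ofMap C),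
        Tendsto (fun j => ThreeOp.stepB γ B (z j)) atTop (𝓝 x) ∧
        Tendsto (fun j => ThreeOp.stepC γ A B C (z j)) atTop (𝓝 x)) := by
  have ha0 : 0 < a := by rw [ha]; exact div_pos (by linarith) (by linarith)
  obtain ⟨N, hN, hTN⟩ := hT
  have hsub : ∀ w, ThreeOp.stepC γ A B C w - ThreeOp.stepB γ B w = a • (N w - w) := by
    intro w
    have h := hTN w
    rw [ThreeOp.splitT] at h
    rw [← sub_eq_zero] at h ⊢
    rw [← h]
    module
  have hTN_iff : ∀ w, ThreeOp.splitT γ A B C w = w ↔ N w = w := by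
    intro w
    rw [← sub_eq_zero (a := N w), ← smul_eq_zero_iff_right (M := X) ha0.ne', ← hsub,
      ThreeOp.splitT, add_sub_left_comm, add_eq_left]
  have hμ : ∀ j, a * lam j ∈ Ioo 0 1 := fun j =>
    ⟨mul_pos ha0 (hlam j).1, by have := (lt_div_iff₀ ha0).1 (hlam j).2; linarith⟩
  have hzN : ∀ j, z (j + 1) = z j + (a * lam j) • (N (z j) - z j) := by
    intro j
    rw [hz, hsub, smul_smul, mul_comm]
  have hsumμ : Tendsto (fun n => ∑ j ∈ Finset.range n, a * lam j) atTop atTop :=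
    tendsto_atTop_mono (fun n => Finset.sum_le_sum fun j _ =>
      mul_le_of_le_one_right (hμ j).1.le (by linarith [(hμ j).1])) hsum
  have hres : ∀ y, N y = y → Tendsto (fun j =>
      ThreeOp.stepC γ A B C (z j) - ThreeOp.stepB γ B (z j)) atTop (𝓝 0) := by
    intro y hy
    simp only [hsub]
    simpa using (ThreeOp.residual_tendsto_zero hN hμ hsum hzN hy).const_smul a
  have hfix : (ThreeOp.zer (A + B + ThreeOp.ofMap C)).Nonempty → ∃ y, N y = y := by
    rintro ⟨x, hx⟩
    obtain ⟨y, hy, hy'⟩ := (ThreeOp.mem_zer_iff hγ.ne').1 hx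
    exact ⟨y, (hTN_iff y).1 (ThreeOp.steps_eq hA hB hβ hC hγ hy hy').2⟩
  have hzer : ∀ y, N y = y → ThreeOp.stepB γ B y ∈ ThreeOp.zer (A + B + ThreeOp.ofMap C) :=
    fun y hy => (ThreeOp.mem_zer_iff hγ.ne').2 ⟨y, ThreeOp.sub_stepB_mem hB hγ y,
      ThreeOp.mem_of_splitT_eq hA hβ hC hγ ((hTN_iff y).2 hy)⟩
  refine ⟨fun hne => ?_, fun _ zs hzs => ?_, fun hne hreg => ?_⟩
  · obtain ⟨y, hy⟩ := hfix hne
    obtain ⟨w, hw, hzw⟩ := ThreeOp.exists_weaklyConverges_fixed hN hμ hsum hzN hy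
    exact ⟨w, (hTN_iff w).2 hw, ThreeOp.weakTendsto_iff.2 hzw⟩
  · rw [ThreeOp.weakTendsto_iff] at hzs
    obtain ⟨R, hR⟩ := hzs.exists_norm_le
    -- Solvability is not assumed here; boundedness of the orbit supplies a fixed point and hence,
    -- by `hzer`, a zero.
    obtain ⟨y, hy⟩ := ThreeOp.exists_fixed_of_bounded_orbit hN hμ hsumμ hzN hR
    have hres := hres y hy
    obtain ⟨hx, hweak⟩ :=
      ThreeOp.weaklyConverges_stepB hA hB hβ hC hγ hR hres (hzer y hy) hzs
    exact ⟨fun x hx => ThreeOp.tendsto_C_stepB hA hB hβ hC hγ hR hres hx, hx,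
      ThreeOp.weakTendsto_iff.2 hweak,
      ThreeOp.weakTendsto_iff.2
        (hweak.of_sub_tendsto_zero (ThreeOp.stepA_sub_stepB_tendsto hβ hC hγ hres)),
      ThreeOp.weakTendsto_iff.2 (hweak.of_sub_tendsto_zero hres)⟩
  · obtain ⟨y, hy⟩ := hfix hne
    have hres := hres y hy
    obtain ⟨w, -, hzw⟩ := ThreeOp.exists_weaklyConverges_fixed hN hμ hsum hzN hy
    obtain ⟨R, hR⟩ := hzw.exists_norm_le
    obtain ⟨hx, hweak⟩ :=
      ThreeOp.weaklyConverges_stepB hA hB hβ hC hγ hR hres (hzer y hy) hzw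
    have hp := ThreeOp.tendsto_stepB hA hB hβ hC hγ hR hres hx hweak hreg
    exact ⟨_, hx, hp, by simpa using hres.add hp⟩
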